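/- All Lie algebras and modules are finite-dimensional over $\mathbb{C}$. Let $\mathfrak{g}$ be a simple complex Lie algebra, $\mathfrak{h}$ a Cartan subalgebra of $\mathfrak{g}$, and $\Phi$ the corresponding root system, with root spaces $\mathfrak{g}_\alpha$ ($\alpha\in\Phi$). A subset $T\subseteq\Phi$ is closed if $\alpha,\beta\in T$ and $\alpha+\beta\in\Phi$ imply $\alpha+\beta\in T$; put $T^r=\{\alpha\in T : -\alpha\in T\}$. For a closed subset $T\subseteq\Phi$ and a subspace $\mathfrak{t}\subseteq\mathfrak{h}$ containing $[\mathfrak{g}_\alpha,\mathfrak{g}_{-\alpha}]$ for every $\alpha\in T^r$, the subalgebra $$\mathfrak{s}_{T,\mathfrak{t}}=\mathfrak{t}\oplus\bigoplus_{\alpha\in T}\mathfrak{g}_\alpha$$ of $\mathfrak{g}$ is called a regular subalgebra. A subalgebra $\mathfrak{s}\subseteq\mathfrak{g}$ is wide if every simple $\mathfrak{g}$-module remains indecomposable when restricted to $\mathfrak{s}$, and narrow if the restriction to $\mathfrak{s}$ of every non-trivial simple $\mathfrak{g}$-module is the direct sum of two non-zero $\mathfrak{s}$-submodules. Theorem.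 The simple Lie algebra $\mathfrak{g}$ is regular extreme: every regular subalgebra of $\mathfrak{g}$ (with respect to any Cartan subalgebra $\mathfrak{h}$) is either narrow or wide. -/

import Mathlib

universe u w

/-- A `k`-module of the Lie algebra `L` has a proper decomposition if it is the internal direct sum
of two non-zero submodules. -/
def LieModule.HasProperDecomposition (k L V : Type*) [CommRing k] [LieRing L] [LieAlgebra k L]
    [AddCommGroup V] [Module k V] [LieRingModule L V] : Prop :=
  ∃ N₁ N₂ : LieSubmodule k L V, N₁ ≠ ⊥ ∧ N₂ ≠ ⊥ ∧ IsCompl N₁ N₂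

/-- A Lie module is indecomposable if it is non-zero and has no proper decomposition. -/
def LieModule.IsIndecomposable (k L V : Type*) [CommRing k] [LieRing L] [LieAlgebra k L]
    [AddCommGroup V] [Module k V] [LieRingModule L V] : Prop :=
  Nontrivial V ∧ ¬ LieModule.HasProperDecomposition k L V

section Extreme

variable {g : Type u} [LieRing g] [LieAlgebra ℂ g]

/-- A subalgebra `s` of `g` is wide if every (finite-dimensional) simple `g`-module remains
indecomposable when restricted to `s`. -/
def LieSubalgebra.IsWide (s : LieSubalgebra ℂ g) : Prop :=
  ∀ (V : Type w) [AddCommGroup V] [Module ℂ V] [LieRingModule g V] [LieModule ℂ g V]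
    [FiniteDimensional ℂ V], LieModule.IsIrreducible ℂ g V → LieModule.IsIndecomposable ℂ s V

/-- A subalgebra `s` of `g` is narrow if the restriction to `s` of every (finite-dimensional)
non-trivial simple `g`-module has a proper decomposition. -/
def LieSubalgebra.IsNarrow (s : LieSubalgebra ℂ g) : Prop :=
  ∀ (V : Type w) [AddCommGroup V] [Module ℂ V] [LieRingModule g V] [LieModule ℂ g V]
    [FiniteDimensional ℂ V], LieModule.IsIrreducible ℂ g V → ¬ LieModule.IsTrivial g V →
      LieModule.HasProperDecomposition ℂ s V

variable [FiniteDimensional ℂ g] [LieAlgebra.IsSemisimple ℂ g]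

open LieAlgebra LieAlgebra.IsKilling

/-- A set `T` of roots is closed if `α + β ∈ T` whenever `α, β ∈ T` and `α + β` is a root. -/
def LieSubalgebra.IsClosedRootSet (H : LieSubalgebra ℂ g) [H.IsCartanSubalgebra]
    (T : Set H.root) : Prop :=
  ∀ α ∈ T, ∀ β ∈ T, ∀ γ : H.root,
    (rootSystem H).root γ = (rootSystem H).root α + (rootSystem H).root β → γ ∈ T

/-- The symmetric part `Tʳ = {α ∈ T | -α ∈ T}` of a set `T` of roots. -/
def LieSubalgebra.symmetricPart (H : LieSubalgebra ℂ g) [H.IsCartanSubalgebra]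
    (T : Set H.root) : Set H.root :=
  {α ∈ T | ∃ β ∈ T, (rootSystem H).root β = -(rootSystem H).root α}

theorem LieSubalgebra.lie_mem_sup_rootSpaces (H : LieSubalgebra ℂ g) [H.IsCartanSubalgebra]
    (T : Set H.root) (hT : H.IsClosedRootSet T) (t : Submodule ℂ g) (htH : t ≤ H.toSubmodule)
    (ht : ∀ α ∈ H.symmetricPart T, ∀ x ∈ rootSpace H (α : LieModule.Weight ℂ H g),
      ∀ y ∈ rootSpace H (-(α : LieModule.Weight ℂ H g)), ⁅x, y⁆ ∈ t) {x y : g}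
    (hx : x ∈ t ⊔ ⨆ α ∈ T, (rootSpace H (α : LieModule.Weight ℂ H g)).toSubmodule)
    (hy : y ∈ t ⊔ ⨆ α ∈ T, (rootSpace H (α : LieModule.Weight ℂ H g)).toSubmodule) :
    ⁅x, y⁆ ∈ t ⊔ ⨆ α ∈ T, (rootSpace H (α : LieModule.Weight ℂ H g)).toSubmodule := by
  set S := t ⊔ ⨆ α ∈ T, (rootSpace H (α : LieModule.Weight ℂ H g)).toSubmodule with hS
  have hle : ∀ α ∈ T, (rootSpace H (α : LieModule.Weight ℂ H g)).toSubmodule ≤ S :=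
    fun α hα => le_sup_of_le_right (le_iSup₂_of_le α hα le_rfl)
  have htS : t ≤ S := le_sup_left
  -- it suffices to check the two kinds of generators of `S`
  have key : ∀ P : Submodule ℂ g, t ≤ P →
      (∀ α ∈ T, (rootSpace H (α : LieModule.Weight ℂ H g)).toSubmodule ≤ P) → S ≤ P :=
    fun P h1 h2 => sup_le h1 (iSup₂_le h2)
  have tt : ∀ a ∈ t, ∀ b ∈ t, ⁅a, b⁆ ∈ S := by
    intro a ha b hb
    have h0 : ⁅(⟨a, htH ha⟩ : H), (⟨b, htH hb⟩ : H)⁆ = 0 := trivial_lie_zero H H _ _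
    have h1 : ⁅a, b⁆ = 0 := congrArg Subtype.val h0
    rw [h1]
    exact S.zero_mem
  have tr : ∀ a ∈ t, ∀ α ∈ T, ∀ b ∈ rootSpace H (α : LieModule.Weight ℂ H g), ⁅a, b⁆ ∈ S :=
    fun a ha α hα b hb => hle α hα ((rootSpace H (α : LieModule.Weight ℂ H g)).lie_mem (x := (⟨a, htH ha⟩ : H)) hb)
  have rr : ∀ α ∈ T, ∀ a ∈ rootSpace H (α : LieModule.Weight ℂ H g),
      ∀ β ∈ T, ∀ b ∈ rootSpace H (β : LieModule.Weight ℂ H g), ⁅a, b⁆ ∈ S := by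
    intro α hα a ha β hβ b hb
    have hab := lie_mem_genWeightSpace_of_mem_genWeightSpace ha hb
    by_cases h0 : ((α : LieModule.Weight ℂ H g) : H → ℂ) + (β : LieModule.Weight ℂ H g) = 0
    · have hneg : ((β : LieModule.Weight ℂ H g) : H → ℂ) = -(α : LieModule.Weight ℂ H g) :=
        eq_neg_of_add_eq_zero_right h0
      refine htS (ht α ⟨hα, β, hβ, ?_⟩ a ha b (hneg ▸ hb))
      ext z
      exact congrFun hneg z
    · by_cases hbot : LieModule.genWeightSpace g
          (((α : LieModule.Weight ℂ H g) : H → ℂ) + ((β : LieModule.Weight ℂ H g) : H → ℂ)) = ⊥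
      · rw [hbot, LieSubmodule.mem_bot] at hab
        rw [hab]
        exact S.zero_mem
      · let γ : LieModule.Weight ℂ H g := ⟨_, hbot⟩
        have hγ : γ ∈ H.root := by
          simp only [LieSubalgebra.root, Finset.mem_filter, Finset.mem_univ, true_and]
          exact h0
        refine hle ⟨γ, hγ⟩ (hT α hα β hβ ⟨γ, hγ⟩ ?_) hab
        ext z
        rfl
  have tS : ∀ a ∈ t, ∀ b ∈ S, ⁅a, b⁆ ∈ S := fun a ha =>
    key (S.comap (ad ℂ g a)) (tt a ha) (tr a ha)
  have rS : ∀ α ∈ T, ∀ a ∈ rootSpace H (α : LieModule.Weight ℂ H g), ∀ b ∈ S, ⁅a, b⁆ ∈ S := by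
    intro α hα a ha
    refine key (S.comap (ad ℂ g a)) (fun b hb => ?_) (rr α hα a ha)
    change ⁅a, b⁆ ∈ S
    rw [← lie_skew]
    exact S.neg_mem (tr b hb α hα a ha)
  rw [← lie_skew]
  refine S.neg_mem (key (S.comap (ad ℂ g y)) (fun a ha => ?_) (fun α hα a ha => ?_) hx)
  · change ⁅y, a⁆ ∈ S
    rw [← lie_skew]
    exact S.neg_mem (tS a ha y hy)
  · change ⁅y, a⁆ ∈ S
    rw [← lie_skew]
    exact S.neg_mem (rS α hα a ha y hy)

/-- The regular subalgebra `𝔰_{T,𝔱} = 𝔱 ⊕ ⨁_{α ∈ T} g_α`, for a closed set `T` of roots with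
respect to the Cartan subalgebra `H`, and a subspace `t` of `H` that contains `[g_α, g_{-α}]` for
all `α` in the symmetric part of `T`. -/
noncomputable def LieSubalgebra.regularSubalgebra (H : LieSubalgebra ℂ g) [H.IsCartanSubalgebra]
    (T : Set H.root) (hT : H.IsClosedRootSet T) (t : Submodule ℂ g) (htH : t ≤ H.toSubmodule)
    (ht : ∀ α ∈ H.symmetricPart T, ∀ x ∈ rootSpace H (α : LieModule.Weight ℂ H g),
      ∀ y ∈ rootSpace H (-(α : LieModule.Weight ℂ H g)), ⁅x, y⁆ ∈ t) :
    LieSubalgebra ℂ g where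
  __ := t ⊔ ⨆ α ∈ T, (rootSpace H (α : LieModule.Weight ℂ H g)).toSubmodule
  lie_mem' := by
    intro x y hx hy
    simp only [AddSubsemigroup.mem_carrier, AddSubmonoid.mem_toSubsemigroup,
      Submodule.mem_toAddSubmonoid] at hx hy ⊢
    exact H.lie_mem_sup_rootSpaces T hT t htH ht hx hy

/-- A subalgebra of the semisimple Lie algebra `g` is regular if it is of the form `𝔰_{T,𝔱}` with
respect to some Cartan subalgebra. -/
def LieSubalgebra.IsRegular (s : LieSubalgebra ℂ g) : Prop :=
  ∃ (H : LieSubalgebra ℂ g) (_ : H.IsCartanSubalgebra) (T : Set H.root)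
    (hT : H.IsClosedRootSet T) (t : Submodule ℂ g) (htH : t ≤ H.toSubmodule)
    (ht : ∀ α ∈ H.symmetricPart T, ∀ x ∈ rootSpace H (α : LieModule.Weight ℂ H g),
      ∀ y ∈ rootSpace H (-(α : LieModule.Weight ℂ H g)), ⁅x, y⁆ ∈ t),
    s = H.regularSubalgebra T hT t htH ht

variable (g) in
/-- A semisimple Lie algebra is regular extreme if each of its regular subalgebras is either narrow
or wide. -/
def LieAlgebra.IsRegularExtreme : Prop :=
  ∀ s : LieSubalgebra ℂ g, s.IsRegular →
    LieSubalgebra.IsNarrow.{u, w} s ∨ LieSubalgebra.IsWide.{u, w} s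

end Extreme

/-! ### Narrow subalgebras: cosets of the lattice generated by `T`. -/

section Narrow

open LieAlgebra LieAlgebra.IsKilling LieModule

/-! The subspace `t` plays no role in the dichotomy: the subalgebra is wide exactly when `T`
generates the root lattice. If some root `α` is not in `H.rootSpan T`, split the weights of `V` into
one coset of this lattice and its complement. Both halves are stable, and a root vector for `α`
moves between them, so the coset can be chosen to make both non-zero (`isNarrow_regularSubalgebra`).
If `T` generates, consider the commutant of the subalgebra in `End V`, graded by `H`-weights. Its
weight-zero elements commute with all of `g` (`lie_eq_zero_of_rootSpan`), hence are scalars by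
Schur. This forces `dim V * tr (ab) = tr a * tr b` on the commutant (`finrank_mul_trace_mul`). A
commuting idempotent then has trace `0` or `dim V`, so it is `0` or `1`. -/

/-- Generalized weight spaces indexed by complementary sets of weights are complementary. -/
theorem LieModule.isCompl_biSup_genWeightSpace (K L M : Type*) [Field K] [LieRing L]
    [LieAlgebra K L] [LieRing.IsNilpotent L] [AddCommGroup M] [Module K M] [LieRingModule L M]
    [LieModule K L M] [FiniteDimensional K M] [IsTriangularizable K L M] (C : Set (L → K)) :
    IsCompl (⨆ χ ∈ C, genWeightSpace M χ) (⨆ χ ∈ Cᶜ, genWeightSpace M χ) := by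
  refine ⟨(iSupIndep_genWeightSpace K L M).disjoint_biSup_biSup disjoint_compl_right, ?_⟩
  rw [codisjoint_iff, ← iSup_union, Set.union_compl_self, iSup_univ, iSup_genWeightSpace_eq_top]

theorem LieModule.lie_mem_biSup_genWeightSpace {K L M : Type*} [Field K] [LieRing L]
    [LieAlgebra K L] (H : LieSubalgebra K L) [LieRing.IsNilpotent H] [AddCommGroup M] [Module K M]
    [LieRingModule L M] [LieModule K L M] {C : Set (H → K)} {α : H → K}
    (hC : ∀ χ ∈ C, α + χ ∈ C) {x : L} (hx : x ∈ rootSpace H α) {m : M}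
    (hm : m ∈ ⨆ χ ∈ C, genWeightSpace M χ) : ⁅x, m⁆ ∈ ⨆ χ ∈ C, genWeightSpace M χ := by
  have key : (⨆ χ ∈ C, (genWeightSpace M χ).toSubmodule) ≤
      (⨆ χ ∈ C, (genWeightSpace M χ).toSubmodule).comap (toEnd K L M x) :=
    iSup₂_le fun χ hχ v hv ↦
      le_iSup₂_of_le (f := fun χ (_ : χ ∈ C) ↦ (genWeightSpace M χ).toSubmodule) (α + χ)
        (hC χ hχ) le_rfl (lie_mem_genWeightSpace_of_mem_genWeightSpace hx hv)
  rw [← LieSubmodule.mem_toSubmodule] at hm ⊢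
  simp only [LieSubmodule.iSup_toSubmodule] at hm ⊢
  exact key hm

variable {g : Type u} [LieRing g] [LieAlgebra ℂ g] [FiniteDimensional ℂ g]

theorem LieSubalgebra.mem_regularSubalgebra [LieAlgebra.IsSemisimple ℂ g]
    (H : LieSubalgebra ℂ g) [H.IsCartanSubalgebra]
    {T : Set H.root} (hT : H.IsClosedRootSet T) {t : Submodule ℂ g} (htH : t ≤ H.toSubmodule)
    (ht : ∀ α ∈ H.symmetricPart T, ∀ x ∈ rootSpace H (α : LieModule.Weight ℂ H g),
      ∀ y ∈ rootSpace H (-(α : LieModule.Weight ℂ H g)), ⁅x, y⁆ ∈ t) (x : g) :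
    x ∈ H.regularSubalgebra T hT t htH ht ↔
      x ∈ t ⊔ ⨆ α ∈ T, (rootSpace H (α : LieModule.Weight ℂ H g)).toSubmodule :=
  Iff.rfl

/-- The subgroup of functions on `H` generated by the set `T` of roots. -/
def LieSubalgebra.rootSpan (H : LieSubalgebra ℂ g) [H.IsCartanSubalgebra]
    (T : Set H.root) : AddSubgroup (H → ℂ) :=
  AddSubgroup.closure {χ | ∃ α ∈ T, χ = ((α : LieModule.Weight ℂ H g) : H → ℂ)}

omit [FiniteDimensional ℂ g] in
-- The kernel of the action is an ideal. Only here is simplicity needed rather than semisimplicity.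
theorem LieModule.exists_lie_ne_zero_of_not_isTrivial [LieAlgebra.IsSimple ℂ g]
    {V : Type*} [AddCommGroup V] [Module ℂ V] [LieRingModule g V] [LieModule ℂ g V]
    (hV : ¬ IsTrivial g V) {x : g} (hx : x ≠ 0) : ∃ v : V, ⁅x, v⁆ ≠ 0 := by
  by_contra! h
  have hker : x ∈ LieModule.ker ℂ g V := (LieModule.mem_ker ℂ g V x).2 h
  rcases LieAlgebra.IsSimple.eq_bot_or_eq_top (LieModule.ker ℂ g V) with hb | ht
  · rw [hb, LieSubmodule.mem_bot] at hker
    exact hx hker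
  · exact hV ⟨fun y v ↦ (LieModule.mem_ker ℂ g V y).1 (ht ▸ LieSubmodule.mem_top y) v⟩

theorem LieSubalgebra.isNarrow_regularSubalgebra [LieAlgebra.IsSimple ℂ g]
    (H : LieSubalgebra ℂ g) [H.IsCartanSubalgebra]
    {T : Set H.root} (hT : H.IsClosedRootSet T) {t : Submodule ℂ g} (htH : t ≤ H.toSubmodule)
    (ht : ∀ α ∈ H.symmetricPart T, ∀ x ∈ rootSpace H (α : LieModule.Weight ℂ H g),
      ∀ y ∈ rootSpace H (-(α : LieModule.Weight ℂ H g)), ⁅x, y⁆ ∈ t)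
    {α : H.root} (hα : ((α : LieModule.Weight ℂ H g) : H → ℂ) ∉ H.rootSpan T) :
    LieSubalgebra.IsNarrow.{u, w} (H.regularSubalgebra T hT t htH ht) := by
  intro V _ _ _ _ _ _ hV
  obtain ⟨x, hx, hx0⟩ := (α : LieModule.Weight ℂ H g).exists_ne_zero
  -- The generalized weight spaces span `V`, so `x` cannot kill all of them.
  obtain ⟨μ, v, hv, hxv⟩ : ∃ μ : H → ℂ, ∃ v ∈ genWeightSpace V μ, ⁅x, v⁆ ≠ 0 := by
    by_contra! h
    obtain ⟨v, hv⟩ := exists_lie_ne_zero_of_not_isTrivial hV hx0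
    have : (⨆ χ : H → ℂ, (genWeightSpace V χ).toSubmodule) ≤ LinearMap.ker (toEnd ℂ g V x) :=
      iSup_le h
    rw [← LieSubmodule.iSup_toSubmodule, iSup_genWeightSpace_eq_top] at this
    exact hv (this (Submodule.mem_top (x := v)))
  have stable : ∀ C : Set (H → ℂ), (∀ β ∈ H.rootSpan T, ∀ χ ∈ C, β + χ ∈ C) →
      ∀ y ∈ H.regularSubalgebra T hT t htH ht, ∀ m ∈ ⨆ χ ∈ C, genWeightSpace V χ,
        ⁅y, m⁆ ∈ ⨆ χ ∈ C, genWeightSpace V χ := by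
    intro C hC y hy m hm
    rw [LieSubalgebra.mem_regularSubalgebra] at hy
    have hle : t ⊔ ⨆ α ∈ T, (rootSpace H (α : LieModule.Weight ℂ H g)).toSubmodule ≤
        (⨆ χ ∈ C, genWeightSpace V χ).toSubmodule.comap
          ((toEnd ℂ g V : g →ₗ[ℂ] Module.End ℂ V).flip m) := by
      refine sup_le (fun a ha ↦ ?_) (iSup₂_le fun β hβ a ha ↦ ?_)
      · exact (⨆ χ ∈ C, genWeightSpace V χ).lie_mem (x := (⟨a, htH ha⟩ : H)) hm
      · exact lie_mem_biSup_genWeightSpace H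
          (hC _ (AddSubgroup.subset_closure ⟨β, hβ, rfl⟩)) ha hm
    exact hle hy
  -- The coset of `μ`: it contains the weight of `v` but not that of `⁅x, v⁆`, as `α` lies outside
  -- the lattice.
  let C : Set (H → ℂ) := {χ | χ - μ ∈ H.rootSpan T}
  have hC : ∀ β ∈ H.rootSpan T, ∀ χ, β + χ ∈ C ↔ χ ∈ C := fun β hβ χ ↦ by
    simp only [C, Set.mem_ofPred_eq, add_sub_assoc, AddSubgroup.add_mem_cancel_left _ hβ]
  have hcompl := isCompl_biSup_genWeightSpace ℂ H V C
  have hle : ∀ {D : Set (H → ℂ)} {χ}, χ ∈ D → genWeightSpace V χ ≤ ⨆ χ ∈ D, genWeightSpace V χ :=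
    fun {D χ} h ↦ le_iSup₂_of_le χ h le_rfl
  let N (D : Set (H → ℂ)) (hD : ∀ β ∈ H.rootSpan T, ∀ χ ∈ D, β + χ ∈ D) :
      LieSubmodule ℂ (H.regularSubalgebra T hT t htH ht) V :=
    { (⨆ χ ∈ D, genWeightSpace V χ).toSubmodule with
      lie_mem := fun {y m} hm ↦ stable D hD y y.2 m hm }
  refine ⟨N C fun β hβ χ hχ ↦ (hC β hβ χ).2 hχ, N Cᶜ fun β hβ χ hχ h ↦ hχ ((hC β hβ χ).1 h),
    ?_, ?_, ?_⟩
  · intro h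
    have hvN : v ∈ (⊥ : LieSubmodule ℂ (H.regularSubalgebra T hT t htH ht) V) :=
      h ▸ hle (D := C) (χ := μ) (by simp [C]) hv
    rw [LieSubmodule.mem_bot] at hvN
    exact hxv (by rw [hvN, lie_zero])
  · intro h
    have hvN : ⁅x, v⁆ ∈ (⊥ : LieSubmodule ℂ (H.regularSubalgebra T hT t htH ht) V) :=
      h ▸ hle (D := Cᶜ) (χ := (α : LieModule.Weight ℂ H g) + μ) (by simpa [C] using hα)
        (lie_mem_genWeightSpace_of_mem_genWeightSpace hx hv)
    exact hxv ((LieSubmodule.mem_bot _).1 hvN)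
  · rw [← LieSubmodule.isCompl_toSubmodule] at hcompl ⊢
    exact hcompl

end Narrow

/-! ### Weight-zero vectors killed by generating root spaces. -/

section Annihilator

open LieAlgebra LieAlgebra.IsKilling LieModule

namespace IsSl2Triple

variable (K : Type*) {L M : Type*} [Field K] [CharZero K] [LieRing L] [LieAlgebra K L]
  [AddCommGroup M] [Module K M] [LieRingModule L M] [LieModule K L M] [FiniteDimensional K M]
  {h e f : L}

include K in
theorem lie_f_eq_zero_of_lie_h_eq_zero (t : IsSl2Triple h e f) {m : M} (hh : ⁅h, m⁆ = 0)
    (he : ⁅e, m⁆ = 0) : ⁅f, m⁆ = 0 := by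
  by_cases hm : m = 0
  · simp [hm]
  have P : HasPrimitiveVectorWith t m (0 : K) := ⟨hm, by simp [hh], he⟩
  simpa using P.pow_toEnd_f_eq_zero_of_eq_nat (n := 0) (by simp)

/-- In a finite-dimensional module a lowest weight is never positive: for the opposite triple, `m`
would be primitive of weight `-n`. -/
theorem eq_zero_of_lie_f_eq_zero (t : IsSl2Triple h e f) {m : M} {n : ℤ} (hn : 0 < n)
    (hh : ⁅h, m⁆ = (n : K) • m) (hf : ⁅f, m⁆ = 0) : m = 0 := by
  by_contra hm
  have P : HasPrimitiveVectorWith t.symm m (-n : K) := ⟨hm, by simp [hh], hf⟩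
  obtain ⟨k, hk⟩ := P.exists_nat
  have : -n = (k : ℤ) := by exact_mod_cast hk
  omega

end IsSl2Triple

variable {g : Type u} [LieRing g] [LieAlgebra ℂ g] [FiniteDimensional ℂ g]
  [LieAlgebra.IsSemisimple ℂ g] (H : LieSubalgebra ℂ g) [H.IsCartanSubalgebra]
  {M : Type*} [AddCommGroup M] [Module ℂ M] [LieRingModule g M] [LieModule ℂ g M]
  [FiniteDimensional ℂ M]

/-- A root vector for `α` that kills a vector of weight zero has a counterpart for `-α`. -/
theorem LieModule.lie_eq_zero_of_mem_rootSpace_neg {m : M} (hm : ∀ h : H, ⁅h, m⁆ = 0)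
    {α : Weight ℂ H g} (hα : α.IsNonZero) (hαm : ∀ x ∈ rootSpace H α, ⁅x, m⁆ = 0) :
    ∀ x ∈ rootSpace H (-α), ⁅x, m⁆ = 0 := by
  obtain ⟨h, e, f, t, he, hf⟩ := exists_isSl2Triple_of_weight_isNonZero hα
  have hh : ⁅h, m⁆ = 0 := by
    rw [t.h_eq_coroot hα he hf]
    exact hm _
  have hfm := t.lie_f_eq_zero_of_lie_h_eq_zero ℂ hh (hαm e he)
  intro x hx
  have hone : Module.finrank ℂ (rootSpace H (-α : Weight ℂ H g)) = 1 :=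
    finrank_rootSpace_eq_one (-α) hα.neg
  have hf' : f ∈ rootSpace H (-α : Weight ℂ H g) := hf
  obtain ⟨c, hc⟩ := (finrank_eq_one_iff_of_nonzero'
    (⟨f, hf'⟩ : rootSpace H (-α : Weight ℂ H g)) (by simpa using t.f_ne_zero)).1 hone ⟨x, hx⟩
  have : x = c • f := (congrArg Subtype.val hc).symm
  rw [this, smul_lie, hfm, smul_zero]

/-- With `f` in the root space of `-α`, Leibniz gives `⁅f, ⁅x, m⁆⁆ = 0`, while `⁅x, m⁆` has positive
weight `n` for the `sl₂` of `α`. -/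
theorem LieModule.lie_eq_zero_of_pairing_pos {m : M} (hm : ∀ h : H, ⁅h, m⁆ = 0)
    {α : Weight ℂ H g} (hα : α.IsNonZero) (hαm : ∀ x ∈ rootSpace H (-α), ⁅x, m⁆ = 0)
    {γ : H → ℂ} {n : ℤ} (hn : 0 < n) (hγ : γ (coroot α) = n)
    (hγα : ∀ x ∈ rootSpace H (γ - α), ⁅x, m⁆ = 0) : ∀ x ∈ rootSpace H γ, ⁅x, m⁆ = 0 := by
  intro x hx
  obtain ⟨h, e, f, t, he, hf⟩ := exists_isSl2Triple_of_weight_isNonZero hα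
  refine t.eq_zero_of_lie_f_eq_zero ℂ hn ?_ ?_
  · have h0 : ⁅((coroot α : H) : g), m⁆ = 0 := hm _
    have h1 : ⁅((coroot α : H) : g), x⁆ = γ (coroot α) • x := lie_eq_smul_of_mem_rootSpace hx _
    rw [t.h_eq_coroot hα he hf, leibniz_lie, h0, lie_zero, add_zero, h1, hγ, smul_lie]
  · have h1 := lie_mem_genWeightSpace_of_mem_genWeightSpace hf hx
    rw [neg_add_eq_sub] at h1
    rw [leibniz_lie, hγα _ h1, hαm f hf, lie_zero, add_zero]

/-- A vector of weight zero killed by root vectors for roots that generate the root lattice is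
invariant. -/
theorem LieModule.lie_eq_zero_of_rootSpan {m : M} (hm : ∀ h : H, ⁅h, m⁆ = 0) {T : Set H.root}
    (hTm : ∀ α ∈ T, ∀ x ∈ rootSpace H (α : Weight ℂ H g), ⁅x, m⁆ = 0)
    (hT : ∀ α : H.root, ((α : Weight ℂ H g) : H → ℂ) ∈ H.rootSpan T) (x : g) : ⁅x, m⁆ = 0 := by
  -- Induction on the number of summands. Arbitrary sums are allowed, since removing a summand may
  -- leave zero or a non-root.
  have hsum : ∀ n : ℕ, ∀ s : Multiset (H → ℂ), s.card = n →
      (∀ χ ∈ s, ∃ α : H.root, χ = (α : Weight ℂ H g) ∧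
        (∀ x ∈ rootSpace H (α : Weight ℂ H g), ⁅x, m⁆ = 0)) →
      ∀ x ∈ rootSpace H s.sum, ⁅x, m⁆ = 0 := by
    classical
    intro n
    induction n with
    | zero =>
      intro s hs _ x hx
      rw [Multiset.card_eq_zero.1 hs, Multiset.sum_zero, rootSpace_zero_eq] at hx
      exact hm ⟨x, hx⟩
    | succ n ih =>
      intro s hs hsm
      by_cases hbot : genWeightSpace g s.sum = ⊥
      · intro x hx
        rw [rootSpace, hbot, LieSubmodule.mem_bot] at hx
        rw [hx, zero_lie]
      by_cases hγ0 : s.sum = 0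
      · intro x hx
        rw [hγ0, rootSpace_zero_eq] at hx
        exact hm ⟨x, hx⟩
      let γ : H.root := ⟨⟨s.sum, hbot⟩, Finset.mem_filter.2 ⟨Finset.mem_univ _, hγ0⟩⟩
      -- The summands pair with the coroot of `γ` to a total of `2`, so one pairing is positive;
      -- real parts supply the order.
      obtain ⟨α, hαs, hαm, hpos⟩ : ∃ α : H.root, ((α : Weight ℂ H g) : H → ℂ) ∈ s ∧
          (∀ x ∈ rootSpace H (α : Weight ℂ H g), ⁅x, m⁆ = 0) ∧
          0 < (rootSystem H).pairingIn ℤ α γ := by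
        by_contra! hneg
        have hle : ∀ χ ∈ s, (χ (coroot γ.1)).re ≤ 0 := by
          intro χ hχ
          obtain ⟨α, rfl, hαm⟩ := hsm χ hχ
          have h1 := (rootSystem H).algebraMap_pairingIn ℤ α γ
          rw [rootSystem_pairing_apply] at h1
          rw [← h1]
          simpa using hneg α hχ hαm
        have h2 : s.sum (coroot γ.1) = 2 := root_apply_coroot (H.isNonZero_coe_root γ)
        have h3 : (s.map fun χ ↦ (χ (coroot γ.1)).re).sum = (s.sum (coroot γ.1)).re := by
          have := map_multiset_sum
            (Complex.reAddGroupHom.comp (Pi.evalAddMonoidHom (fun _ : H ↦ ℂ) (coroot γ.1))) s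
          simpa using this.symm
        have h4 : (s.map fun χ ↦ (χ (coroot γ.1)).re).sum ≤ 0 :=
          (Multiset.sum_le_card_nsmul _ 0 (by simpa using hle)).trans_eq (smul_zero _)
        rw [h3, h2] at h4
        norm_num at h4
      rw [RootPairing.zero_lt_pairingIn_iff'] at hpos
      have hαnz := H.isNonZero_coe_root α
      refine lie_eq_zero_of_pairing_pos H hm hαnz
        (lie_eq_zero_of_mem_rootSpace_neg H hm hαnz hαm) hpos ?_ ?_
      · have h1 := (rootSystem H).algebraMap_pairingIn ℤ γ α
        rw [rootSystem_pairing_apply] at h1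
        exact h1.symm
      · have := ih (s.erase (α : Weight ℂ H g)) (by simp [Multiset.card_erase_of_mem hαs, hs])
          fun χ hχ ↦ hsm χ (Multiset.mem_of_mem_erase hχ)
        rwa [← Multiset.sum_erase hαs, add_sub_cancel_left]
  have hroot : ∀ α : H.root, ∀ x ∈ rootSpace H (α : Weight ℂ H g), ⁅x, m⁆ = 0 := by
    intro α
    have hα := hT α
    -- The group generated by `T` is the monoid generated by `T ∪ -T`, and negatives also kill `m`.
    rw [LieSubalgebra.rootSpan, ← AddSubgroup.mem_toAddSubmonoid,
      AddSubgroup.closure_toAddSubmonoid] at hα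
    obtain ⟨s, hs, hsum'⟩ := AddSubmonoid.exists_multiset_of_mem_closure hα
    rw [← hsum']
    refine hsum _ s rfl fun χ hχ ↦ ?_
    rcases hs χ hχ with ⟨β, hβ, rfl⟩ | ⟨β, hβ, hχβ⟩
    · exact ⟨β, rfl, hTm β hβ⟩
    · have hβnz := H.isNonZero_coe_root β
      exact ⟨⟨-β.1, by simpa [LieSubalgebra.root] using hβnz⟩, by simp [← hχβ],
        lie_eq_zero_of_mem_rootSpace_neg H hm hβnz (hTm β hβ)⟩
  have hle : (⨆ χ : H → ℂ, (rootSpace H χ).toSubmodule) ≤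
      LinearMap.ker ((toEnd ℂ g M : g →ₗ[ℂ] Module.End ℂ M).flip m) := by
    refine iSup_le fun χ x hx ↦ ?_
    change ⁅x, m⁆ = 0
    replace hx : x ∈ genWeightSpace g χ := hx
    by_cases hbot : genWeightSpace g χ = ⊥
    · rw [hbot, LieSubmodule.mem_bot] at hx
      rw [hx, zero_lie]
    by_cases hχ0 : χ = 0
    · rw [hχ0, ← rootSpace, rootSpace_zero_eq] at hx
      exact hm ⟨x, hx⟩
    · exact hroot ⟨⟨χ, hbot⟩, Finset.mem_filter.2 ⟨Finset.mem_univ _, hχ0⟩⟩ x hx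
  rw [← LieSubmodule.iSup_toSubmodule, iSup_genWeightSpace_eq_top] at hle
  exact hle (Submodule.mem_top (x := x))

end Annihilator

/-! ### Wide subalgebras: traces on the commutant. -/

section Wide

open LieAlgebra LieAlgebra.IsKilling LieModule

/-- An endomorphism whose eigenspaces span is semisimple. -/
theorem Module.End.isSemisimple_of_iSup_eigenspace_eq_top {K V : Type*} [Field K] [AddCommGroup V]
    [Module K V] [FiniteDimensional K V] {f : Module.End K V} (hf : ⨆ c, f.eigenspace c = ⊤) :
    f.IsSemisimple := by
  classical
  let p : Polynomial K := ∏ c ∈ (Module.End.finite_hasEigenvalue f).toFinset,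
    (Polynomial.X - Polynomial.C c)
  have hp : Squarefree p := (Polynomial.separable_prod_X_sub_C_iff' (f := id).2
    fun _ _ _ _ h ↦ h).squarefree
  refine Module.End.isSemisimple_of_squarefree_aeval_eq_zero hp ?_
  rw [← LinearMap.ker_eq_top, eq_top_iff, ← hf]
  refine iSup_le fun c v hv ↦ ?_
  by_cases hv0 : v = 0
  · simp [hv0]
  have hvc : f.HasEigenvector c v := ⟨hv, hv0⟩
  have hc : c ∈ (Module.End.finite_hasEigenvalue f).toFinset := by
    simpa using Module.End.hasEigenvalue_of_hasEigenvector hvc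
  rw [LinearMap.mem_ker, Module.End.aeval_apply_of_hasEigenvector hvc, Polynomial.eval_prod,
    Finset.prod_eq_zero hc (by simp), zero_smul]

section Trace

variable {K L V : Type*} [Field K] [LieRing L] [LieAlgebra K L] [AddCommGroup V] [Module K V]
  [LieRingModule L V] [LieModule K L V]

theorem LieModule.lie_end_eq (x : L) (f : Module.End K V) :
    ⁅x, f⁆ = toEnd K L V x * f - f * toEnd K L V x := by
  ext v
  simp [LieHom.lie_apply]

theorem LieModule.lie_end_mul (x : L) (a b : Module.End K V) :
    ⁅x, a * b⁆ = ⁅x, a⁆ * b + a * ⁅x, b⁆ := by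
  simp only [lie_end_eq]
  noncomm_ring

theorem LieModule.trace_eq_zero_of_lie_eq_smul {x : L} {a : Module.End K V} {c : K}
    (hc : c ≠ 0) (ha : ⁅x, a⁆ = c • a) : LinearMap.trace K V a = 0 := by
  have h := congrArg (LinearMap.trace K V) ha
  rw [lie_end_eq, map_sub, LinearMap.trace_mul_comm, sub_self, map_smul, smul_eq_mul] at h
  exact (mul_eq_zero.1 h.symm).resolve_left hc

/-- Compute `tr (⁅x, a⁆ * b)` twice: it is `c * k * dim V`, and by cyclicity it is `k * tr x - k *
tr x = 0`. -/
theorem LieModule.eq_zero_of_mul_eq_algebraMap [CharZero K] [FiniteDimensional K V] [Nontrivial V]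
    {x : L} {a b : Module.End K V} {c k : K} (hc : c ≠ 0) (ha : ⁅x, a⁆ = c • a)
    (hab : a * b = algebraMap K _ k) (hba : b * a = algebraMap K _ k) : k = 0 := by
  have h := congrArg (fun y ↦ LinearMap.trace K V (y * b)) ha
  simp only [lie_end_eq, sub_mul, smul_mul_assoc, hab] at h
  rw [mul_assoc, hab, map_sub, LinearMap.trace_mul_comm _ (a * _) b, ← mul_assoc, hba,
    ← Algebra.commutes, sub_self, map_smul, Algebra.algebraMap_eq_smul_one, map_smul,
    LinearMap.trace_one] at h
  simpa [hc, Module.finrank_pos.ne'] using h.symm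

/-- Schur's lemma for invariant endomorphisms. -/
theorem LieModule.exists_eq_algebraMap_of_lie_eq_zero [IsAlgClosed K] [FiniteDimensional K V]
    [LieModule.IsIrreducible K L V] {f : Module.End K V} (hf : ∀ x : L, ⁅x, f⁆ = 0) :
    ∃ k : K, f = algebraMap K _ k := by
  have : Nontrivial V := nontrivial_of_isIrreducible K L V
  obtain ⟨k, hk⟩ := Module.End.exists_eigenvalue f
  let N : LieSubmodule K L V :=
    { f.eigenspace k with
      lie_mem := fun {x v} hv ↦ by
        have hv' : f v = k • v := Module.End.mem_eigenspace_iff.1 hv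
        have h := LinearMap.congr_fun (hf x) v
        rw [LieHom.lie_apply, hv', lie_smul, LinearMap.zero_apply, sub_eq_zero] at h
        exact Module.End.mem_eigenspace_iff.2 h.symm }
  have hN : N = ⊤ := (eq_bot_or_eq_top N).resolve_left fun h ↦
    hk (by simpa [N] using congrArg LieSubmodule.toSubmodule h)
  refine ⟨k, LinearMap.ext fun v ↦ ?_⟩
  have hv : v ∈ N := hN ▸ LieSubmodule.mem_top v
  simpa [Module.algebraMap_end_apply] using Module.End.mem_eigenspace_iff.1 hv

end Trace

variable {g : Type u} [LieRing g] [LieAlgebra ℂ g] [FiniteDimensional ℂ g]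
  [LieAlgebra.IsSemisimple ℂ g] (H : LieSubalgebra ℂ g) [H.IsCartanSubalgebra]
  {V : Type*} [AddCommGroup V] [Module ℂ V] [LieRingModule g V] [LieModule ℂ g V]
  [FiniteDimensional ℂ V]

/-- A Cartan subalgebra acts semisimply on a simple module. -/
theorem LieModule.isSemisimple_toEnd_of_isIrreducible [LieModule.IsIrreducible ℂ g V] (h : H) :
    (toEnd ℂ g V h).IsSemisimple := by
  apply Module.End.isSemisimple_of_iSup_eigenspace_eq_top
  have : Nontrivial V := nontrivial_of_isIrreducible ℂ g V
  set N : Submodule ℂ V := ⨆ c, (toEnd ℂ g V h).eigenspace c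
  -- Root vectors shift eigenvalues of `h`, so the sum of the eigenspaces is a non-zero
  -- `g`-submodule.
  have stable : ∀ x : g, ∀ v ∈ N, ⁅x, v⁆ ∈ N := by
    intro x
    suffices N ≤ N.comap (toEnd ℂ g V x) from this
    refine iSup_le fun c v hv ↦ ?_
    have hle : (⨆ χ : H → ℂ, (rootSpace H χ).toSubmodule) ≤
        N.comap ((toEnd ℂ g V : g →ₗ[ℂ] Module.End ℂ V).flip v) := by
      refine iSup_le fun χ y hy ↦ ?_
      refine Submodule.mem_iSup_of_mem (χ h + c) (Module.End.mem_eigenspace_iff.2 ?_)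
      change ⁅(h : g), ⁅y, v⁆⁆ = (χ h + c) • ⁅y, v⁆
      have h1 : ⁅(h : g), y⁆ = χ h • y := lie_eq_smul_of_mem_rootSpace hy h
      have h2 : ⁅(h : g), v⁆ = c • v := Module.End.mem_eigenspace_iff.1 hv
      rw [leibniz_lie, h1, h2, smul_lie, lie_smul, add_smul]
    rw [← LieSubmodule.iSup_toSubmodule, iSup_genWeightSpace_eq_top] at hle
    exact hle (Submodule.mem_top (x := x))
  obtain ⟨c, hc⟩ := Module.End.exists_eigenvalue (toEnd ℂ g V h)
  let N' : LieSubmodule ℂ g V := { N with lie_mem := fun {x v} ↦ stable x v }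
  have htop : N' = ⊤ := (eq_bot_or_eq_top N').resolve_left fun hbot ↦ hc (le_bot_iff.1
    ((le_iSup (toEnd ℂ g V h).eigenspace c).trans (congrArg LieSubmodule.toSubmodule hbot).le))
  exact congrArg LieSubmodule.toSubmodule htop

/-- The commutator with a semisimple endomorphism is semisimple, so generalized weight vectors are
true ones. -/
theorem LieModule.lie_end_eq_smul_of_mem_genWeightSpace [LieModule.IsIrreducible ℂ g V]
    {χ : H → ℂ} {a : Module.End ℂ V} (ha : a ∈ genWeightSpace (Module.End ℂ V) χ) (h : H) :
    ⁅h, a⁆ = χ h • a := by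
  have hss : (toEnd ℂ g (Module.End ℂ V) h).IsSemisimple := by
    have := LieAlgebra.ad_isSemisimple_of_isSemisimple
      (isSemisimple_toEnd_of_isIrreducible H (V := V) h)
    exact this
  replace ha : a ∈ (toEnd ℂ g (Module.End ℂ V) h).maxGenEigenspace (χ h) :=
    genWeightSpace_le_genWeightSpaceOf (Module.End ℂ V) h χ ha
  rw [hss.isFinitelySemisimple.maxGenEigenspace_eq_eigenspace,
    Module.End.mem_eigenspace_iff] at ha
  exact ha

/-- The endomorphisms commuting with a subalgebra that is stable under a Cartan subalgebra. -/
def LieModule.commutant (s : LieSubalgebra ℂ g) (hs : ∀ h : H, ∀ y ∈ s, ⁅(h : g), y⁆ ∈ s) :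
    LieSubmodule ℂ H (Module.End ℂ V) where
  carrier := {f | ∀ y ∈ s, ⁅y, f⁆ = 0}
  add_mem' ha hb y hy := by rw [lie_add, ha y hy, hb y hy, add_zero]
  zero_mem' y _ := lie_zero y
  smul_mem' c f hf y hy := by rw [lie_smul, hf y hy, smul_zero]
  lie_mem {h f} hf y hy := by
    have h1 := hf _ (hs h y hy)
    rw [lie_lie, hf y hy, lie_zero, zero_sub, neg_eq_zero] at h1
    exact h1

/-- By bilinearity it suffices to treat weight vectors of the commutant, where non-zero weights have
trace zero and weight zero means scalar. -/
theorem LieModule.finrank_mul_trace_mul [LieModule.IsIrreducible ℂ g V] {T : Set H.root}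
    (hT : ∀ α : H.root, ((α : Weight ℂ H g) : H → ℂ) ∈ H.rootSpan T) (s : LieSubalgebra ℂ g)
    (hs : ∀ h : H, ∀ y ∈ s, ⁅(h : g), y⁆ ∈ s)
    (hTs : ∀ α ∈ T, (rootSpace H (α : Weight ℂ H g)).toSubmodule ≤ s.toSubmodule)
    {a b : Module.End ℂ V} (ha : ∀ y ∈ s, ⁅y, a⁆ = 0) (hb : ∀ y ∈ s, ⁅y, b⁆ = 0) :
    Module.finrank ℂ V * LinearMap.trace ℂ V (a * b) =
      LinearMap.trace ℂ V a * LinearMap.trace ℂ V b := by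
  have : Nontrivial V := nontrivial_of_isIrreducible ℂ g V
  have scalar : ∀ f : Module.End ℂ V, (∀ y ∈ s, ⁅y, f⁆ = 0) → (∀ h : H, ⁅h, f⁆ = 0) →
      ∃ k : ℂ, f = algebraMap ℂ _ k := fun f hf hf0 ↦
    exists_eq_algebraMap_of_lie_eq_zero (L := g) <| lie_eq_zero_of_rootSpan H hf0
      (fun α hα x hx ↦ hf x (hTs α hα hx)) hT
  have hmul : ∀ {a b : Module.End ℂ V}, (∀ y ∈ s, ⁅y, a⁆ = 0) → (∀ y ∈ s, ⁅y, b⁆ = 0) →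
      ∀ y ∈ s, ⁅y, a * b⁆ = 0 := fun ha hb y hy ↦ by
    rw [lie_end_mul, ha y hy, hb y hy, zero_mul, mul_zero, add_zero]
  have hmulH : ∀ {a b : Module.End ℂ V} {χ ψ : ℂ} {h : g}, ⁅h, a⁆ = χ • a → ⁅h, b⁆ = ψ • b →
      ⁅h, a * b⁆ = (χ + ψ) • (a * b) := fun ha hb ↦ by
    rw [lie_end_mul, ha, hb, smul_mul_assoc, mul_smul_comm, add_smul]
  have key : ∀ {a b : Module.End ℂ V} {χ ψ : H → ℂ}, (∀ y ∈ s, ⁅y, a⁆ = 0) →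
      (∀ y ∈ s, ⁅y, b⁆ = 0) → (∀ h : H, ⁅(h : g), a⁆ = χ h • a) →
      (∀ h : H, ⁅(h : g), b⁆ = ψ h • b) →
      Module.finrank ℂ V * LinearMap.trace ℂ V (a * b) =
      LinearMap.trace ℂ V a * LinearMap.trace ℂ V b := by
    intro a b χ ψ ha hb hχ hψ
    by_cases h0 : ∃ h, χ h + ψ h ≠ 0
    · obtain ⟨h, hh⟩ := h0
      rw [trace_eq_zero_of_lie_eq_smul hh (hmulH (hχ h) (hψ h)), mul_zero]
      by_cases hχh : χ h = 0
      · rw [trace_eq_zero_of_lie_eq_smul (by simpa [hχh] using hh) (hψ h), mul_zero]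
      · rw [trace_eq_zero_of_lie_eq_smul hχh (hχ h), zero_mul]
    push Not at h0
    obtain ⟨k, hk⟩ := scalar _ (hmul ha hb) fun h ↦
      (hmulH (hχ h) (hψ h)).trans (by rw [h0, zero_smul])
    by_cases hχ0 : ∃ h, χ h ≠ 0
    -- Opposite non-zero weights: `a * b` and `b * a` are scalars, equal by their traces, hence
    -- zero.
    · obtain ⟨h, hh⟩ := hχ0
      obtain ⟨k', hk'⟩ := scalar _ (hmul hb ha) fun h ↦
        (hmulH (hψ h) (hχ h)).trans (by rw [add_comm, h0, zero_smul])
      have hkk : k = k' := by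
        have h1 := LinearMap.trace_mul_comm ℂ a b
        rw [hk, hk'] at h1
        simpa [Algebra.algebraMap_eq_smul_one, LinearMap.trace_one, Module.finrank_pos.ne'] using h1
      subst hkk
      rw [trace_eq_zero_of_lie_eq_smul hh (hχ h), hk,
        eq_zero_of_mul_eq_algebraMap hh (hχ h) hk hk']
      simp
    · push Not at hχ0
      obtain ⟨p, rfl⟩ := scalar a ha fun h ↦ (hχ h).trans (by rw [hχ0, zero_smul])
      obtain ⟨q, rfl⟩ := scalar b hb fun h ↦ (hψ h).trans (by
        rw [← zero_add (ψ h), ← hχ0 h, h0, zero_smul])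
      simp only [Algebra.algebraMap_eq_smul_one, smul_mul_assoc, one_mul, map_smul,
        LinearMap.trace_one, smul_eq_mul]
      ring
  let E : LieSubmodule ℂ H (Module.End ℂ V) := commutant H s hs
  have hE : E.toSubmodule =
      ⨆ χ : Weight ℂ H (Module.End ℂ V), (E ⊓ genWeightSpace (Module.End ℂ V) χ).toSubmodule := by
    rw [← LieSubmodule.iSup_toSubmodule, ← eq_iSup_inf_genWeightSpace]
  have haE : a ∈ E.toSubmodule := ha
  have hbE : b ∈ E.toSubmodule := hb
  rw [hE] at haE hbE
  clear ha hb
  induction haE using Submodule.iSup_induction' with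
  | zero => simp
  | add x y _ _ hx hy => rw [add_mul, map_add, map_add, mul_add, hx, hy, add_mul]
  | mem χ a ha =>
    induction hbE using Submodule.iSup_induction' with
    | zero => simp
    | add x y _ _ hx hy => rw [mul_add, map_add, map_add, mul_add, hx, hy, mul_add]
    | mem ψ b hb =>
      exact key ha.1 hb.1 (lie_end_eq_smul_of_mem_genWeightSpace H ha.2)
        (lie_end_eq_smul_of_mem_genWeightSpace H hb.2)

/-- A subalgebra that is stable under a Cartan subalgebra and contains root spaces for roots
generating the root lattice is wide. -/
theorem LieSubalgebra.isWide_of_rootSpan {T : Set H.root}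
    (hT : ∀ α : H.root, ((α : Weight ℂ H g) : H → ℂ) ∈ H.rootSpan T) (s : LieSubalgebra ℂ g)
    (hs : ∀ h : H, ∀ y ∈ s, ⁅(h : g), y⁆ ∈ s)
    (hTs : ∀ α ∈ T, (rootSpace H (α : Weight ℂ H g)).toSubmodule ≤ s.toSubmodule) :
    LieSubalgebra.IsWide.{u, w} s := by
  intro V _ _ _ _ _ hV
  refine ⟨nontrivial_of_isIrreducible ℂ g V, ?_⟩
  rintro ⟨N₁, N₂, h₁, h₂, hc⟩
  rw [← LieSubmodule.isCompl_toSubmodule] at hc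
  -- The projection onto `N₁` along `N₂` is an idempotent of the commutant.
  let e : Module.End ℂ V := N₁.toSubmodule.projection N₂.toSubmodule hc
  have he : IsIdempotentElem e := Submodule.isIdempotentElem_projection hc
  have hes : ∀ y ∈ s, ⁅y, e⁆ = 0 := by
    intro y hy
    ext v
    rw [LieHom.lie_apply, LinearMap.zero_apply, sub_eq_zero]
    have h1 : ⁅y, e v⁆ ∈ N₁.toSubmodule :=
      N₁.lie_mem (x := (⟨y, hy⟩ : s)) (Submodule.projection_apply_mem hc v)
    have h2 : ⁅y, v - e v⁆ ∈ N₂.toSubmodule :=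
      N₂.lie_mem (x := (⟨y, hy⟩ : s)) (Submodule.sub_projection_mem hc v)
    have h3 : e ⁅y, e v⁆ = ⁅y, e v⁆ := Submodule.projection_apply_of_mem_left hc h1
    have h4 : e ⁅y, v - e v⁆ = 0 := (Submodule.projection_apply_eq_zero_iff hc).2 h2
    rw [lie_sub, map_sub, h3, sub_eq_zero] at h4
    exact h4.symm
  -- With `a = b = e` this reads `dim V * tr e = (tr e)²`; in characteristic zero an idempotent of
  -- trace zero vanishes.
  have htr := finrank_mul_trace_mul H hT s hs hTs hes hes
  rw [he.eq, ← sub_eq_zero, ← sub_mul, mul_eq_zero, sub_eq_zero] at htr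
  rcases htr with htr | htr
  · have : LinearMap.trace ℂ V (1 - e) = 0 := by
      rw [map_sub, LinearMap.trace_one, htr, sub_self]
    have h1 := LinearMap.IsIdempotentElem.eq_zero_of_trace_eq_zero he.one_sub this
    refine h₂ ((LieSubmodule.toSubmodule_eq_bot _).1 ?_)
    rw [← Submodule.ker_projection hc, LinearMap.ker_eq_bot']
    intro v hv
    have h3 := LinearMap.congr_fun h1 v
    rwa [LinearMap.sub_apply, hv, sub_zero] at h3
  · refine h₁ ((LieSubmodule.toSubmodule_eq_bot _).1 ?_)
    rw [← Submodule.range_projection hc]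
    exact LinearMap.range_eq_bot.2 (LinearMap.IsIdempotentElem.eq_zero_of_trace_eq_zero he htr)

theorem LieSubalgebra.rootSpace_le_regularSubalgebra
    {T : Set H.root} (hT : H.IsClosedRootSet T) {t : Submodule ℂ g} (htH : t ≤ H.toSubmodule)
    (ht : ∀ α ∈ H.symmetricPart T, ∀ x ∈ rootSpace H (α : Weight ℂ H g),
      ∀ y ∈ rootSpace H (-(α : Weight ℂ H g)), ⁅x, y⁆ ∈ t) {α : H.root} (hα : α ∈ T) :
    (rootSpace H (α : Weight ℂ H g)).toSubmodule ≤
      (H.regularSubalgebra T hT t htH ht).toSubmodule := by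
  have h : (rootSpace H (α : Weight ℂ H g)).toSubmodule ≤
      ⨆ β ∈ T, (rootSpace H (β : Weight ℂ H g)).toSubmodule :=
    le_iSup₂_of_le α hα le_rfl
  intro x hx
  rw [LieSubalgebra.mem_toSubmodule, LieSubalgebra.mem_regularSubalgebra]
  exact Submodule.mem_sup_right (h hx)

theorem LieSubalgebra.lie_mem_regularSubalgebra
    {T : Set H.root} (hT : H.IsClosedRootSet T) {t : Submodule ℂ g} (htH : t ≤ H.toSubmodule)
    (ht : ∀ α ∈ H.symmetricPart T, ∀ x ∈ rootSpace H (α : Weight ℂ H g),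
      ∀ y ∈ rootSpace H (-(α : Weight ℂ H g)), ⁅x, y⁆ ∈ t) (h : H) {y : g}
    (hy : y ∈ H.regularSubalgebra T hT t htH ht) :
    ⁅(h : g), y⁆ ∈ H.regularSubalgebra T hT t htH ht := by
  have hle : t ⊔ ⨆ α ∈ T, (rootSpace H (α : Weight ℂ H g)).toSubmodule ≤
      (H.regularSubalgebra T hT t htH ht).toSubmodule.comap (ad ℂ g h) := by
    refine sup_le (fun a ha ↦ ?_) (iSup₂_le fun α hα a ha ↦ ?_)
    · have h0 : ⁅h, (⟨a, htH ha⟩ : H)⁆ = 0 := trivial_lie_zero H H _ _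
      have h1 : ad ℂ g h a = 0 := congrArg Subtype.val h0
      rw [Submodule.mem_comap, h1]
      exact zero_mem _
    · exact H.rootSpace_le_regularSubalgebra hT htH ht hα
        ((rootSpace H (α : Weight ℂ H g)).lie_mem (x := h) ha)
  exact hle hy

end Wide

/-- Every finite-dimensional simple complex Lie algebra is regular extreme. -/
theorem mainTheorem1 (g : Type u) [LieRing g] [LieAlgebra ℂ g] [FiniteDimensional ℂ g]
    [LieAlgebra.IsSimple ℂ g] : LieAlgebra.IsRegularExtreme.{u, w} g := by
  rintro s ⟨H, _, T, hT, t, htH, ht, rfl⟩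
  by_cases hspan : ∀ α : H.root, ((α : LieModule.Weight ℂ H g) : H → ℂ) ∈ H.rootSpan T
  · exact Or.inr (LieSubalgebra.isWide_of_rootSpan H hspan _
      (fun h _ hy ↦ H.lie_mem_regularSubalgebra hT htH ht h hy)
      fun _ hα ↦ H.rootSpace_le_regularSubalgebra hT htH ht hα)
  · push Not at hspan
    obtain ⟨α, hα⟩ := hspan
    exact Or.inl (H.isNarrow_regularSubalgebra hT htH ht hα)
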